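/- Let $d\ge 1$ and let $C:\mathbb R^d\to\mathbb R$ satisfy condition $\mathcal K(\rho)$: $C$ is symmetric ($C(-x)=C(x)$), continuous, in $L^2(\mathbb R^d)$, $C(0)=\rho$, and its ($L^2$-)Fourier transform satisfies $0\le\mathcal F(C)\le 1$ almost everywhere. Let $\mathbf X$ be a simple point process on $\mathbb R^d$, i.e. a measurable map from a probability space into the set of locally finite subsets of $\mathbb R^d$ (with the $\sigma$-algebra generated by the counts of points in bounded Borel sets), and for $k\ge1$ let $\alpha^{(k)}$ be its factorial moment measure on $(\mathbb R^d)^k$: $\alpha^{(k)}(D)$ is the expected number of $k$-tuples of pairwise distinct points of $\mathbf X$ that lie in $D$. Suppose $\mathbf X$ is a determinantal point process with kernel $C$: for every $k\ge 1$, $\alpha^{(k)}$ has a density with respect to Lebesgue measure which equals $\det\big[C(x_i-x_j)\big]_{1\le i,j\le k}$ for almost every $(x_1,\dots,x_k)$. The $k$-th factorial cumulant moment measure $\gamma_{[k]}$ is defined, for bounded Borel sets $A_1,\dots,A_k\subset\mathbb R^d$, by \[ \gamma_{[k]}\Big(\prod_{i=1}^k A_i\Big)=\sum_{j=1}^k(-1)^{j-1}(j-1)!\sum_{\{B_1,\dots,B_j\}}\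 \prod_{i=1}^j\alpha^{(|B_i|)}\Big(\prod_{m\in B_i}A_m\Big), \] the inner sum being over all partitions of $\{1,\dots,k\}$ into $j$ non-empty sets $B_1,\dots,B_j$. Then for every bounded Borel set $A\subset\mathbb R^d$ and every $k\ge 2$, the numbers $\alpha^{(r)}(A^r)$, $r\ge1$, are finite, the integrand below is integrable on $A^k$, and \[ \gamma_{[k]}(A^k)=(-1)^{k+1}(k-1)!\int_{A^k}C(x_2-x_1)\,C(x_3-x_2)\cdots C(x_k-x_{k-1})\,C(x_1-x_k)\,dx_1\cdots dx_k . \] -/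

import Mathlib

open MeasureTheory FourierTransform
open scoped ENNReal NNReal Nat ComplexOrder

noncomputable section

namespace DPP

/-- `ℝ^d` with its Euclidean structure, Borel sigma-algebra and Lebesgue measure. -/
abbrev Space (d : ℕ) : Type := EuclideanSpace ℝ (Fin d)

/-- Locally finite configurations of points in `ℝ^d`: the subsets which have finitely many points
in every bounded Borel set. -/
def Configuration (d : ℕ) : Type :=
  {x : Set (Space d) // ∀ B : Set (Space d), Bornology.IsBounded B → MeasurableSet B →
    (x ∩ B).Finite}

/-- The number of points of the configuration `x` in `B`. -/
def Configuration.count {d : ℕ} (x : Configuration d) (B : Set (Space d)) : ℕ :=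
  (x.1 ∩ B).ncard

/-- The sigma-algebra generated by the sets `{x | x(B) = n}`, with `B` bounded Borel, `n ≥ 0`. -/
instance instMeasurableSpaceConfiguration (d : ℕ) : MeasurableSpace (Configuration d) :=
  MeasurableSpace.generateFrom
    {S | ∃ (B : Set (Space d)) (n : ℕ), Bornology.IsBounded B ∧ MeasurableSet B ∧
      S = {x : Configuration d | x.count B = n}}

/-- The `k`-tuples of pairwise distinct points of the configuration `x`. -/
def distinctTuples {d : ℕ} (x : Configuration d) (k : ℕ) : Set (Fin k → Space d) :=
  {y | Function.Injective y ∧ ∀ i, y i ∈ x.1}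

/-- The factorial moment measure `α^(k)(D)` of order `k` of the point process `X`: the expected
number of `k`-tuples of pairwise distinct points of `X` that lie in `D ⊆ (ℝ^d)^k`. -/
def factorialMoment {d : ℕ} {Ω : Type*} [MeasurableSpace Ω] (P : Measure Ω)
    (X : Ω → Configuration d) (k : ℕ) (D : Set (Fin k → Space d)) : ℝ≥0∞ :=
  ∫⁻ ω, (((distinctTuples (X ω) k ∩ D).encard : ℕ∞) : ℝ≥0∞) ∂P

/-- `r` is a joint intensity of order `k` of `X`, that is, a density of the factorial moment
measure of order `k` with respect to Lebesgue measure. -/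
def IsJointIntensity {d : ℕ} {Ω : Type*} [MeasurableSpace Ω] (P : Measure Ω)
    (X : Ω → Configuration d) (k : ℕ) (r : (Fin k → Space d) → ℝ≥0) : Prop :=
  Measurable r ∧ ∀ D : Set (Fin k → Space d), MeasurableSet D →
    factorialMoment P X k D = ∫⁻ x in D, (r x : ℝ≥0∞)

/-- The matrix `[C](x_1, …, x_k)` with entries `C (x_i - x_j)`. -/
def kernelMatrix {d : ℕ} (C : Space d → ℝ) {k : ℕ} (x : Fin k → Space d) :
    Matrix (Fin k) (Fin k) ℝ :=
  Matrix.of fun i j => C (x i - x j)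

/-- The point process `X` is a stationary determinantal point process with kernel `C`: for every
`k ≥ 1` it has a joint intensity of order `k`, equal almost everywhere to
`det [C](x_1, …, x_k)`. -/
def IsDPP {d : ℕ} {Ω : Type*} [MeasurableSpace Ω] (P : Measure Ω)
    (X : Ω → Configuration d) (C : Space d → ℝ) : Prop :=
  ∀ k : ℕ, 1 ≤ k → ∃ r : (Fin k → Space d) → ℝ≥0, IsJointIntensity P X k r ∧
    ∀ᵐ x : Fin k → Space d, (r x : ℝ) = (kernelMatrix C x).det

/-- Condition `K(ρ)`. The Fourier transform on `L²` is the Plancherel extension of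
`h ↦ (t ↦ ∫ h(x) exp(2iπ x·t) dx)`, which is Mathlib's `𝓕⁻`; the inequalities in `ℂ`
say that the transform is almost everywhere real with values in `[0, 1]`. -/
structure ConditionK {d : ℕ} (C : Space d → ℝ) (ρ : ℝ) : Prop where
  symmetric : ∀ x, C (-x) = C x
  continuous : Continuous C
  memLp : MemLp C 2 volume
  value_zero : C 0 = ρ
  fourier : ∀ᵐ t : Space d,
    0 ≤ (𝓕⁻ ((memLp.ofReal (K := ℂ)).toLp _) : Lp ℂ 2 (volume : Measure (Space d))) t ∧
      (𝓕⁻ ((memLp.ofReal (K := ℂ)).toLp _) : Lp ℂ 2 (volume : Measure (Space d))) t ≤ 1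

/-- The factorial cumulant moment measure `γ_[k]` of `X` on the product `A_1 × ⋯ × A_k`:
`∑_{j=1}^k (-1)^(j-1) (j-1)! ∑ ∏_{B} α^(|B|)(∏_{i ∈ B} A_i)`, where the inner sum is over the
partitions of the index set into `j` nonempty blocks `B`. -/
def factorialCumulant {d : ℕ} {Ω : Type*} [MeasurableSpace Ω] (P : Measure Ω)
    (X : Ω → Configuration d) (k : ℕ) (A : Fin k → Set (Space d)) : ℝ :=
  ∑ j ∈ Finset.Icc 1 k, (-1 : ℝ) ^ (j - 1) * ((j - 1)! : ℝ) *
    ∑ π : Finpartition (Finset.univ : Finset (Fin k)) with π.parts.card = j,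
      ∏ B ∈ π.parts,
        (factorialMoment P X B.card (Set.univ.pi fun i => A (B.orderEmbOfFin rfl i))).toReal

/-- The cyclic product `C(x_2 - x_1) C(x_3 - x_2) ⋯ C(x_1 - x_k)`. -/
def cyclicProduct {d : ℕ} (C : Space d → ℝ) {k : ℕ} (x : Fin k → Space d) : ℝ :=
  ∏ i : Fin k, C (x (finRotate k i) - x i)

end DPP

end

/-! On bounded `A` the process has moments `a n = ∫_{A^n} det [C (x_i - x_j)]`. Formally, `∑ a n z^n
/ n!` is the Fredholm determinant `det (1 + z K)` of the kernel restricted to `A`, and its logarithm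
is `∑ (-1)^(n-1) tr (K^n) z^n / n`. The partition formula extracts `n!` times the coefficient of the
logarithm, namely `(-1)^(n-1) (n-1)! tr (K^n)`, and the trace is the cyclic integral.

The code avoids operator theory and convergence. Both sides meet in the recursion `a (n+1) = ∑ i, (n
choose i) κ (i+1) a (n-i)`: `Finset.sum_blockSum_eq_cumulant` shows with formal power series that it
makes `κ` the cumulants, and `detIntegral_succ` derives it for `κ (i+1) = (-1)^i i! tr (K^(i+1))` by
expanding bordered determinants. `integral_cyclic_prod` unfolds the trace, and
`DPP.factorialMoment_pi_eq` identifies the moments. -/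

/-! ### Partition sums and moment-cumulant inversion. -/

section Cumulants

variable {α : Type*} [DecidableEq α]

/-- The sum over the partitions of `s` into `j` blocks of the products of the weights `a #B` of
their blocks: a partial Bell polynomial. -/
def Finset.blockSum (a : ℕ → ℝ) (s : Finset α) (j : ℕ) : ℝ :=
  ∑ π : Finpartition s with π.parts.card = j, ∏ B ∈ π.parts, a B.card

theorem Finpartition.parts_avoid_of_mem {s B : Finset α} (π : Finpartition s) (hB : B ∈ π.parts) :
    (π.avoid B).parts = π.parts.erase B := by
  ext c
  rw [Finpartition.mem_avoid, Finset.mem_erase]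
  constructor
  · rintro ⟨D, hD, hDB, rfl⟩
    have hne : D ≠ B := fun h => hDB h.le
    have hdisj : Disjoint D B := π.disjoint hD hB hne
    rw [sdiff_eq_left.mpr hdisj]
    exact ⟨hne, hD⟩
  · rintro ⟨hne, hc⟩
    have hdisj : Disjoint c B := π.disjoint hc hB hne
    exact ⟨c, hc, fun h => π.ne_bot hc (hdisj.eq_bot_of_le h), sdiff_eq_left.mpr hdisj⟩

/-- Deleting the block `B` is a bijection onto the partitions of `s \ B`, with inverse
`Finpartition.extend`. -/
theorem Finset.sum_finpartition_part_eq (a : ℕ → ℝ) {s B : Finset α} {x : α} (hB : B ⊆ s)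
    (hx : x ∈ B) (j : ℕ) :
    ∑ π : Finpartition s with π.parts.card = j + 1 ∧ π.part x = B, ∏ D ∈ π.parts, a D.card =
      a B.card * Finset.blockSum a (s \ B) j := by
  have hB0 : B ≠ ⊥ := Finset.ne_empty_of_mem hx
  have hnot : ∀ π : Finpartition (s \ B), B ∉ π.parts := fun π h =>
    (Finset.mem_sdiff.mp (π.le h hx)).2 hx
  rw [Finset.blockSum, Finset.mul_sum]
  symm
  refine Finset.sum_bij (fun π _ => π.extend hB0 disjoint_sdiff_self_left
    (sdiff_sup_cancel hB)) ?_ ?_ ?_ ?_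
  · intro π hπ
    simp only [Finset.mem_filter, Finset.mem_univ, true_and] at hπ ⊢
    refine ⟨by rw [Finpartition.card_extend, hπ], ?_⟩
    exact Finpartition.part_eq_of_mem _ (by simp) hx
  · intro π _ τ _ h
    have h' := congrArg Finpartition.parts h
    simp only [Finpartition.extend_parts] at h'
    ext1
    rw [← Finset.erase_insert (hnot π), h', Finset.erase_insert (hnot τ)]
  · intro τ hτ
    simp only [Finset.mem_filter, Finset.mem_univ, true_and] at hτ
    have hBτ : B ∈ τ.parts := by
      rw [← hτ.2]; exact τ.part_mem.mpr (hB hx)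
    refine ⟨τ.avoid B, ?_, ?_⟩
    · simp only [Finset.mem_filter, Finset.mem_univ, true_and]
      rw [τ.parts_avoid_of_mem hBτ, Finset.card_erase_of_mem hBτ, hτ.1, Nat.add_sub_cancel]
    · ext1
      rw [Finpartition.extend_parts, τ.parts_avoid_of_mem hBτ, Finset.insert_erase hBτ]
  · intro π _
    rw [Finpartition.extend_parts, Finset.prod_insert (hnot π)]

/-- Partitions are sorted by the block that contains the marked point `x`. -/
theorem Finset.blockSum_succ (a : ℕ → ℝ) {s : Finset α} {x : α} (hx : x ∈ s) (j : ℕ) :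
    Finset.blockSum a s (j + 1) =
      ∑ B ∈ s.powerset with x ∈ B, a B.card * Finset.blockSum a (s \ B) j := by
  rw [Finset.blockSum, ← Finset.sum_fiberwise_of_maps_to
    (t := s.powerset.filter (x ∈ ·)) (g := fun π : Finpartition s => π.part x)]
  · refine Finset.sum_congr rfl fun B hB => ?_
    rw [Finset.mem_filter, Finset.mem_powerset] at hB
    rw [Finset.filter_filter, Finset.sum_finpartition_part_eq a hB.1 hB.2]
  · intro π _
    rw [Finset.mem_filter, Finset.mem_powerset]
    exact ⟨π.part_subset x, π.mem_part_self.mpr hx⟩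

/-- A sum over the subsets of a set containing a given point, of a function of the size. -/
theorem Finset.sum_powerset_filter_mem {s : Finset α} {x : α} (hx : x ∈ s) (g : ℕ → ℝ) :
    ∑ B ∈ s.powerset with x ∈ B, g B.card =
      ∑ i ∈ Finset.range s.card, ((s.card - 1).choose i : ℝ) * g (i + 1) := by
  have hn : (s.erase x).card = s.card - 1 := Finset.card_erase_of_mem hx
  have h1 : s.card - 1 + 1 = s.card := Nat.sub_add_cancel (Finset.card_pos.mpr ⟨x, hx⟩)
  have h2 : ∑ B ∈ s.powerset with x ∈ B, g B.card =
      ∑ B ∈ (s.erase x).powerset, g (B.card + 1) := by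
    symm
    refine Finset.sum_bij' (fun B _ => insert x B) (fun B _ => B.erase x) ?_ ?_ ?_ ?_ ?_
    · intro B hB
      rw [Finset.mem_powerset] at hB
      simp only [Finset.mem_filter, Finset.mem_powerset, Finset.mem_insert_self, and_true]
      exact Finset.insert_subset hx (hB.trans (Finset.erase_subset _ _))
    · intro B hB
      simp only [Finset.mem_filter, Finset.mem_powerset] at hB ⊢
      exact Finset.erase_subset_erase _ hB.1
    · intro B hB
      exact Finset.erase_insert fun h => by
        simpa using Finset.mem_powerset.mp hB h
    · intro B hB
      exact Finset.insert_erase (Finset.mem_filter.mp hB).2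
    · intro B hB
      rw [Finset.card_insert_of_notMem fun h => by simpa using Finset.mem_powerset.mp hB h]
  rw [h2, Finset.sum_powerset_apply_card (fun m => g (m + 1)), hn, h1]
  simp only [nsmul_eq_mul]

open PowerSeries in
/-- Bell polynomials are the coefficients of the powers of the exponential generating function. -/
theorem Finset.factorial_mul_blockSum (a : ℕ → ℝ) (F : ℝ⟦X⟧) (hF0 : coeff 0 F = 0)
    (hF : ∀ n, coeff (n + 1) F = a (n + 1) / ((n + 1)! : ℝ)) (j : ℕ) (s : Finset α) :
    (j ! : ℝ) * Finset.blockSum a s j = (s.card ! : ℝ) * coeff s.card (F ^ j) := by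
  induction j generalizing s with
  | zero =>
    rcases s.eq_empty_or_nonempty with rfl | hs
    · have : (Finset.univ : Finset (Finpartition (∅ : Finset α))) = {Finpartition.empty _} := by
        ext π
        simp only [Finset.mem_univ, Finset.mem_singleton, true_iff]
        exact Subsingleton.elim (α := Finpartition (⊥ : Finset α)) _ _
      simp [Finset.blockSum, this]
    · have h0 : Finset.blockSum a s 0 = 0 := by
        rw [Finset.blockSum, Finset.filter_eq_empty_iff.mpr, Finset.sum_empty]
        intro π _ h
        exact hs.ne_empty (π.parts_eq_empty_iff.mp (Finset.card_eq_zero.mp h))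
      simp [h0, coeff_one, hs.ne_empty]
  | succ j ih =>
    rcases s.eq_empty_or_nonempty with rfl | ⟨x, hx⟩
    · have h0 : Finset.blockSum a (∅ : Finset α) (j + 1) = 0 := by
        rw [Finset.blockSum, Finset.filter_eq_empty_iff.mpr, Finset.sum_empty]
        intro π _ h
        have := π.parts_eq_empty_iff.mpr rfl
        simp [this] at h
      have hc : constantCoeff F = 0 := by simpa using hF0
      simp [h0, hc]
    · have hj : (j ! : ℝ) ≠ 0 := by positivity
      have hT : ∀ t : Finset α, Finset.blockSum a t j =
          (t.card ! : ℝ) * coeff t.card (F ^ j) / (j ! : ℝ) := fun t => by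
        rw [← ih t]; field_simp
      obtain ⟨n, hn⟩ : ∃ n, s.card = n + 1 :=
        ⟨s.card - 1, (Nat.sub_add_cancel (Finset.card_pos.mpr ⟨x, hx⟩)).symm⟩
      -- Differentiating `F ^ (j + 1)` mirrors marking a point: the factor `F'` is the block of `x`,
      -- and `F ^ j` the remaining `j` blocks.
      have key : coeff n (d⁄dX ℝ (F ^ (j + 1))) =
          (j + 1 : ℝ) * ∑ i ∈ Finset.range (n + 1),
            (a (i + 1) / (i ! : ℝ)) * coeff (n - i) (F ^ j) := by
        rw [derivative_pow, Nat.add_sub_cancel, mul_assoc, mul_comm (F ^ j)]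
        rw [show ((j + 1 : ℕ) : ℝ⟦X⟧) = C ((j + 1 : ℕ) : ℝ) by simp, coeff_C_mul, coeff_mul,
          Finset.Nat.sum_antidiagonal_eq_sum_range_succ
            (fun p q => coeff p (d⁄dX ℝ F) * coeff q (F ^ j))]
        push_cast
        congr 1
        refine Finset.sum_congr rfl fun i _ => ?_
        rw [coeff_derivative, hF, Nat.factorial_succ]
        push_cast
        field_simp
      rw [coeff_derivative] at key
      have hsum : Finset.blockSum a s (j + 1) =
          ∑ i ∈ Finset.range (n + 1), ((n.choose i : ℕ) : ℝ) *
            (a (i + 1) * (((n - i) ! : ℝ) * coeff (n - i) (F ^ j) / (j ! : ℝ))) := by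
        rw [Finset.blockSum_succ a hx]
        have := Finset.sum_powerset_filter_mem hx
          (fun m => a m * (((s.card - m) ! : ℝ) * coeff (s.card - m) (F ^ j) / (j ! : ℝ)))
        rw [hn, Nat.add_sub_cancel] at this
        simp only [Nat.add_sub_add_right] at this
        rw [← this]
        refine Finset.sum_congr rfl fun B hB => ?_
        rw [Finset.mem_filter, Finset.mem_powerset] at hB
        rw [hT, Finset.card_sdiff_of_subset hB.1, hn]
      have h3 : (((n + 1)! : ℕ) : ℝ) * coeff (n + 1) (F ^ (j + 1)) =
          (n ! : ℝ) * (coeff (n + 1) (F ^ (j + 1)) * ((n : ℝ) + 1)) := by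
        rw [Nat.factorial_succ]; push_cast; ring
      rw [hn, h3, key, hsum, Nat.factorial_succ, Finset.mul_sum, Finset.mul_sum, Finset.mul_sum]
      refine Finset.sum_congr rfl fun i hi => ?_
      have hi' : i ≤ n := Nat.lt_succ_iff.mp (Finset.mem_range.mp hi)
      rw [Nat.cast_choose ℝ hi']
      have : (((n - i)! : ℕ) : ℝ) ≠ 0 := by positivity
      have : ((i ! : ℕ) : ℝ) ≠ 0 := by positivity
      push_cast
      field_simp

open PowerSeries in
/-- Moment-cumulant inversion: the recursion `a (n+1) = ∑ i, (n choose i) κ (i+1) a (n-i)`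
characterises the cumulants. -/
theorem Finset.sum_blockSum_eq_cumulant (a κ : ℕ → ℝ) (ha0 : a 0 = 1)
    (hrec : ∀ n, a (n + 1) =
      ∑ i ∈ Finset.range (n + 1), (n.choose i : ℝ) * κ (i + 1) * a (n - i))
    (s : Finset α) (hs : s.Nonempty) :
    ∑ j ∈ Finset.Icc 1 s.card,
      (-1 : ℝ) ^ (j - 1) * ((j - 1)! : ℝ) * Finset.blockSum a s j = κ s.card := by
  obtain ⟨k, hk⟩ : ∃ k, s.card = k + 1 :=
    ⟨s.card - 1, (Nat.sub_add_cancel hs.card_pos).symm⟩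
  set A : ℝ⟦X⟧ := PowerSeries.mk fun n => a n / (n ! : ℝ) with hA
  set F : ℝ⟦X⟧ := A - 1 with hF
  set K : ℝ⟦X⟧ := PowerSeries.mk fun n => κ (n + 1) / (n ! : ℝ) with hK
  -- `L` is `log A = log (1 + F)` truncated after `k + 1` terms. Since `F` has no constant term,
  -- this is exact up to degree `k + 1`.
  set L : ℝ⟦X⟧ := ∑ i ∈ Finset.range (k + 1), C ((-1 : ℝ) ^ i / (i + 1)) * F ^ (i + 1) with hL
  have hF0 : coeff 0 F = 0 := by simp [hF, hA, ha0]
  have hFs : ∀ n, coeff (n + 1) F = a (n + 1) / ((n + 1)! : ℝ) := fun n => by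
    simp [hF, hA, coeff_one]
  have hdA : d⁄dX ℝ F = d⁄dX ℝ A := by simp [hF]
  -- The recursion for `a` says precisely that `K` is the logarithmic derivative of `A`.
  have hAK : A * K = d⁄dX ℝ A := by
    ext n
    rw [mul_comm, coeff_mul, Finset.Nat.sum_antidiagonal_eq_sum_range_succ
      (fun p q => coeff p K * coeff q A), coeff_derivative]
    simp only [hA, hK, coeff_mk]
    rw [hrec n, Finset.sum_div, Finset.sum_mul]
    refine Finset.sum_congr rfl fun i hi => ?_
    have hi' : i ≤ n := Nat.lt_succ_iff.mp (Finset.mem_range.mp hi)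
    rw [Nat.cast_choose ℝ hi', Nat.factorial_succ]
    push_cast
    field_simp
  have hdL : d⁄dX ℝ L = (∑ i ∈ Finset.range (k + 1), (-F) ^ i) * d⁄dX ℝ F := by
    rw [hL, map_sum, Finset.sum_mul]
    refine Finset.sum_congr rfl fun i _ => ?_
    have hneg : (-F) ^ i = C ((-1 : ℝ) ^ i) * F ^ i := by
      rw [neg_pow]
      simp
    rw [Derivation.leibniz, derivative_C, smul_zero, add_zero, smul_eq_mul, derivative_pow,
      Nat.add_sub_cancel, ← mul_assoc, ← mul_assoc,
      show ((i + 1 : ℕ) : ℝ⟦X⟧) = C ((i + 1 : ℕ) : ℝ) by simp, ← map_mul, hneg]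
    congr 3
    push_cast
    field_simp
  -- The finite geometric sum gives the truncation error exactly; it is divisible by `X ^ (k + 1)`.
  have hmul : A * (K - d⁄dX ℝ L) = (-F) ^ (k + 1) * d⁄dX ℝ F := by
    have hg := mul_neg_geom_sum (-F) (k + 1)
    have hA1 : A = 1 - -F := by simp [hF]
    rw [mul_sub, hAK, hdL, ← mul_assoc]
    nth_rewrite 2 [hA1]
    rw [hg, hdA]
    ring
  have hXF : X ∣ -F := by
    rw [X_dvd_iff]
    simpa using hF0
  have hdvd : X ^ (k + 1) ∣ K - d⁄dX ℝ L := by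
    have hunit : IsUnit A := by
      rw [isUnit_iff_constantCoeff, ← coeff_zero_eq_constantCoeff_apply, hA, coeff_mk]
      simp [ha0]
    rw [← hunit.dvd_mul_left, hmul]
    exact (pow_dvd_pow_of_dvd hXF _).mul_right _
  have hcoeff := X_pow_dvd_iff.mp hdvd k (Nat.lt_succ_self k)
  rw [map_sub, sub_eq_zero, coeff_derivative, hK, coeff_mk, hL, map_sum] at hcoeff
  have hκ : κ (k + 1) = (((k + 1)! : ℕ) : ℝ) *
      ∑ i ∈ Finset.range (k + 1), (-1 : ℝ) ^ i / (i + 1) * coeff (k + 1) (F ^ (i + 1)) := by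
    have hk0 : ((k ! : ℕ) : ℝ) ≠ 0 := by positivity
    rw [div_eq_iff hk0] at hcoeff
    simp only [coeff_C_mul] at hcoeff
    rw [hcoeff, Nat.factorial_succ]
    push_cast
    ring
  rw [hk, hκ, Finset.mul_sum]
  refine Finset.sum_nbij' (· - 1) (· + 1) ?_ ?_ ?_ ?_ ?_
  · intro j hj
    simp only [Finset.mem_Icc, Finset.mem_range] at hj ⊢
    omega
  · intro j hj
    simp only [Finset.mem_Icc, Finset.mem_range] at hj ⊢
    omega
  · intro j hj
    exact Nat.sub_add_cancel (Finset.mem_Icc.mp hj).1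
  · intro j _
    exact Nat.add_sub_cancel j 1
  · intro j hj
    obtain ⟨i, rfl⟩ : ∃ i, j = i + 1 :=
      ⟨j - 1, (Nat.sub_add_cancel (Finset.mem_Icc.mp hj).1).symm⟩
    have hb := Finset.factorial_mul_blockSum a F hF0 hFs (i + 1) s
    rw [hk, Nat.factorial_succ] at hb
    push_cast at hb
    simp only [Nat.add_sub_cancel]
    field_simp
    linear_combination hb

end Cumulants

/-! ### A class of functions making every integrability check automatic. -/

section BoundedMeasurable

variable {α β : Type*} [MeasurableSpace α] [MeasurableSpace β]

/-- Bounded measurable real functions. -/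
def BoundedMeasurable (f : α → ℝ) : Prop :=
  Measurable f ∧ ∃ M, ∀ x, |f x| ≤ M

namespace BoundedMeasurable

theorem const (c : ℝ) : BoundedMeasurable (fun _ : α => c) :=
  ⟨measurable_const, |c|, fun _ => le_rfl⟩

theorem comp {f : β → ℝ} (hf : BoundedMeasurable f) {g : α → β} (hg : Measurable g) :
    BoundedMeasurable (fun x => f (g x)) :=
  ⟨hf.1.comp hg, hf.2.imp fun _ h x => h (g x)⟩

theorem mul {f g : α → ℝ} (hf : BoundedMeasurable f) (hg : BoundedMeasurable g) :
    BoundedMeasurable (fun x => f x * g x) := by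
  obtain ⟨hfm, M, hM⟩ := hf
  obtain ⟨hgm, N, hN⟩ := hg
  refine ⟨hfm.mul hgm, M * N, fun x => ?_⟩
  rw [abs_mul]
  exact mul_le_mul (hM x) (hN x) (abs_nonneg _) ((abs_nonneg _).trans (hM x))

theorem add {f g : α → ℝ} (hf : BoundedMeasurable f) (hg : BoundedMeasurable g) :
    BoundedMeasurable (fun x => f x + g x) := by
  obtain ⟨hfm, M, hM⟩ := hf
  obtain ⟨hgm, N, hN⟩ := hg
  exact ⟨hfm.add hgm, M + N, fun x => (abs_add_le _ _).trans (add_le_add (hM x) (hN x))⟩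

theorem prod {ι : Type*} {f : ι → α → ℝ} (s : Finset ι) (hf : ∀ i, BoundedMeasurable (f i)) :
    BoundedMeasurable (fun x => ∏ i ∈ s, f i x) := by
  classical
  induction s using Finset.induction_on with
  | empty => simpa using const 1
  | insert i s hi ih => simpa only [Finset.prod_insert hi] using (hf i).mul ih

theorem sum {ι : Type*} {f : ι → α → ℝ} (s : Finset ι) (hf : ∀ i, BoundedMeasurable (f i)) :
    BoundedMeasurable (fun x => ∑ i ∈ s, f i x) := by
  classical
  induction s using Finset.induction_on with
  | empty => simpa using const 0
  | insert i s hi ih => simpa only [Finset.sum_insert hi] using (hf i).add ih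

theorem det {n : ℕ} {f : Fin n → Fin n → α → ℝ} (hf : ∀ i j, BoundedMeasurable (f i j)) :
    BoundedMeasurable (fun x => (Matrix.of fun i j => f i j x).det) := by
  simp only [Matrix.det_apply', Matrix.of_apply]
  exact sum _ fun σ => (const _).mul (prod _ fun i => hf _ _)

theorem integrable {f : α → ℝ} (hf : BoundedMeasurable f) (μ : Measure α) [IsFiniteMeasure μ] :
    Integrable f μ := by
  obtain ⟨hfm, M, hM⟩ := hf
  exact Integrable.of_bound hfm.aestronglyMeasurable M (Filter.Eventually.of_forall hM)

theorem integral_right {f : α × β → ℝ} (hf : BoundedMeasurable f) (μ : Measure β)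
    [IsFiniteMeasure μ] : BoundedMeasurable (fun x => ∫ y, f (x, y) ∂μ) := by
  obtain ⟨hfm, M, hM⟩ := hf
  exact ⟨hfm.stronglyMeasurable.integral_prod_right'.measurable, M * μ.real Set.univ,
    fun x => norm_integral_le_of_norm_le_const (μ := μ) (f := fun y => f (x, y))
      (Filter.Eventually.of_forall fun y => hM (x, y))⟩

end BoundedMeasurable

end BoundedMeasurable

/-! ### Fredholm's recursion for integrals of determinants. -/

section Fredholm

variable {E : Type*}

/-- Laplace expansion along the row of `x`. In the minor omitting the column of `z l`, a cycle of
sign `(-1) ^ l` moves the row of `z l` to the top; against the cofactor sign `(-1) ^ (l + 1)` this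
leaves a minus. -/
theorem Matrix.det_kernel_cons {n : ℕ} (K : E → E → ℝ) (x y : E) (z : Fin (n + 1) → E) :
    (Matrix.of fun i j => K ((Fin.cons x z : Fin (n + 2) → E) i)
        ((Fin.cons y z : Fin (n + 2) → E) j)).det =
      K x y * (Matrix.of fun i j => K (z i) (z j)).det -
        ∑ l, K x (z l) * (Matrix.of fun i j =>
          K ((Fin.cons (z l) (l.removeNth z) : Fin (n + 1) → E) i)
            ((Fin.cons y (l.removeNth z) : Fin (n + 1) → E) j)).det := by
  rw [Matrix.det_succ_row_zero, Fin.sum_univ_succ, sub_eq_add_neg, ← Finset.sum_neg_distrib]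
  congr 1
  · simp only [Fin.val_zero, pow_zero, one_mul, Matrix.of_apply, Fin.cons_zero]
    congr 2
  · refine Finset.sum_congr rfl fun l _ => ?_
    have hdet : (Matrix.of fun i j =>
          K ((Fin.cons (z l) (l.removeNth z) : Fin (n + 1) → E) i)
            ((Fin.cons y (l.removeNth z) : Fin (n + 1) → E) j)).det =
        (-1) ^ (l : ℕ) * ((Matrix.of fun i j => K ((Fin.cons x z : Fin (n + 2) → E) i)
        ((Fin.cons y z : Fin (n + 2) → E) j)).submatrix Fin.succ l.succ.succAbove).det := by
      have hs : (((Equiv.Perm.sign l.cycleRange⁻¹ : ℤˣ) : ℤ) : ℝ) = (-1) ^ (l : ℕ) := by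
        simp
      rw [← hs, ← Matrix.det_permute]
      congr 1
      ext i j
      simp only [Matrix.of_apply, Matrix.submatrix_apply, id, Fin.cons_succ]
      congr 1
      · have := Fin.insertNth_apply_cycleRange_symm l (z l) (l.removeNth z) i
        rw [Fin.insertNth_self_removeNth] at this
        exact this.symm
      · cases j using Fin.cases with
        | zero => simp
        | succ j => simp [Fin.removeNth]
    rw [hdet]
    simp only [Fin.val_succ, Matrix.of_apply, Fin.cons_zero, Fin.cons_succ]
    have h1 : ((-1 : ℝ) ^ (l : ℕ)) * (-1) ^ (l : ℕ) = 1 := by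
      rw [← mul_pow]; simp
    ring

variable [MeasurableSpace E] (μ : Measure E)

theorem MeasureTheory.integral_pi_insertNth [SigmaFinite μ] {n : ℕ} (l : Fin (n + 1)) {f : (Fin (n + 1) → E) → ℝ}
    (hf : Integrable f (Measure.pi fun _ => μ)) :
    ∫ z, f z ∂(Measure.pi fun _ => μ) =
      ∫ w, ∫ z, f (l.insertNth w z) ∂(Measure.pi fun _ => μ) ∂μ := by
  have hmp := (measurePreserving_piFinSuccAbove (fun _ : Fin (n + 1) => μ) l).symm
  rw [← hmp.integral_comp', integral_prod]
  · rfl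
  · exact (hmp.integrable_comp_emb (MeasurableEquiv.measurableEmbedding _)).mpr hf

theorem measurable_cons {n : ℕ} {α : Type*} [MeasurableSpace α] {f : α → E} {g : α → Fin n → E}
    (hf : Measurable f) (hg : Measurable g) (i : Fin (n + 1)) :
    Measurable fun t => (Fin.cons (f t) (g t) : Fin (n + 1) → E) i := by
  cases i using Fin.cases with
  | zero => simpa using hf
  | succ i => simpa [Function.comp_def] using (measurable_pi_apply i).comp hg

variable {K : E → E → ℝ}

/-- The iterates of the integral operator with kernel `K`. -/
noncomputable def iteratedKernel (K : E → E → ℝ) : ℕ → E → E → ℝ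
  | 0 => K
  | j + 1 => fun x y => ∫ w, K x w * iteratedKernel K j w y ∂μ

/-- The integrals `∫ det [K (z i) (z j)] dz` over `n`-tuples `z`. -/
noncomputable def detIntegral (K : E → E → ℝ) (n : ℕ) : ℝ :=
  ∫ z : Fin n → E, (Matrix.of fun i j => K (z i) (z j)).det ∂(Measure.pi fun _ => μ)

/-- Fredholm's minors: the integrals of the determinants of `K` bordered by `x` and `y`. -/
noncomputable def fredholmMinor (K : E → E → ℝ) (n : ℕ) (x y : E) : ℝ :=
  ∫ z : Fin n → E, (Matrix.of fun i j => K ((Fin.cons x z : Fin (n + 1) → E) i)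
    ((Fin.cons y z : Fin (n + 1) → E) j)).det ∂(Measure.pi fun _ => μ)

theorem detIntegral_zero : detIntegral μ K 0 = 1 := by
  simp [detIntegral, Measure.real]

theorem fredholmMinor_zero (x y : E) : fredholmMinor μ K 0 x y = K x y := by
  simp [fredholmMinor, Measure.real]

variable [IsFiniteMeasure μ]

theorem boundedMeasurable_iteratedKernel (hK : BoundedMeasurable (Function.uncurry K)) (j : ℕ) :
    BoundedMeasurable (Function.uncurry (iteratedKernel μ K j)) := by
  induction j with
  | zero => exact hK
  | succ j ih =>
    have h : BoundedMeasurable fun p : (E × E) × E =>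
        Function.uncurry K (p.1.1, p.2) * Function.uncurry (iteratedKernel μ K j) (p.2, p.1.2) :=
      (hK.comp (by fun_prop)).mul (ih.comp (by fun_prop))
    exact h.integral_right μ

theorem BoundedMeasurable.comp₂ {α : Type*} [MeasurableSpace α]
    (hK : BoundedMeasurable (Function.uncurry K)) {f g : α → E} (hf : Measurable f)
    (hg : Measurable g) : BoundedMeasurable fun t => K (f t) (g t) :=
  hK.comp (hf.prodMk hg)

theorem boundedMeasurable_kernel_det {α : Type*} [MeasurableSpace α]
    (hK : BoundedMeasurable (Function.uncurry K)) {n : ℕ} {f g : Fin n → α → E}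
    (hf : ∀ i, Measurable (f i)) (hg : ∀ i, Measurable (g i)) :
    BoundedMeasurable fun t => (Matrix.of fun i j => K (f i t) (g j t)).det :=
  BoundedMeasurable.det fun i j => hK.comp ((hf i).prodMk (hg j))

/-- In the integrated row expansion, all `n + 1` values of `l` contribute equally, by Fubini with `z
l` as outer variable. -/
theorem fredholmMinor_succ (hK : BoundedMeasurable (Function.uncurry K)) (n : ℕ) (x y : E) :
    fredholmMinor μ K (n + 1) x y = K x y * detIntegral μ K (n + 1) -
      (n + 1) * ∫ w, K x w * fredholmMinor μ K n w y ∂μ := by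
  have hrem : ∀ l : Fin (n + 1), Measurable fun z : Fin (n + 1) → E => l.removeNth z := fun l =>
    measurable_pi_lambda _ fun i => measurable_pi_apply _
  have h1 : BoundedMeasurable fun z : Fin (n + 1) → E => (Matrix.of fun i j => K (z i) (z j)).det :=
    boundedMeasurable_kernel_det hK measurable_pi_apply measurable_pi_apply
  have h2 : ∀ l : Fin (n + 1), BoundedMeasurable fun z : Fin (n + 1) → E =>
      K x (z l) * (Matrix.of fun i j =>
          K ((Fin.cons (z l) (l.removeNth z) : Fin (n + 1) → E) i)
            ((Fin.cons y (l.removeNth z) : Fin (n + 1) → E) j)).det := fun l =>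
    (hK.comp (measurable_const.prodMk (measurable_pi_apply l))).mul
      (boundedMeasurable_kernel_det hK (measurable_cons (measurable_pi_apply l) (hrem l))
        (measurable_cons measurable_const (hrem l)))
  have h3 : ∀ l : Fin (n + 1), ∫ z : Fin (n + 1) → E, K x (z l) * (Matrix.of fun i j =>
          K ((Fin.cons (z l) (l.removeNth z) : Fin (n + 1) → E) i)
            ((Fin.cons y (l.removeNth z) : Fin (n + 1) → E) j)).det ∂(Measure.pi fun _ => μ) =
      ∫ w, K x w * fredholmMinor μ K n w y ∂μ := fun l => by
    rw [integral_pi_insertNth μ l ((h2 l).integrable _)]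
    simp only [Fin.insertNth_apply_same, Fin.removeNth_insertNth, integral_const_mul]
    rfl
  rw [fredholmMinor]
  simp only [Matrix.det_kernel_cons]
  rw [integral_sub (((BoundedMeasurable.const _).mul h1).integrable _)
    ((BoundedMeasurable.sum _ h2).integrable _), integral_const_mul,
    integral_finsetSum _ fun l _ => (h2 l).integrable _]
  simp only [h3, Finset.sum_const, Finset.card_univ, Fintype.card_fin, nsmul_eq_mul]
  push_cast
  rfl

theorem fredholmMinor_eq_sum (hK : BoundedMeasurable (Function.uncurry K)) (n : ℕ) (x y : E) :
    fredholmMinor μ K n x y = ∑ i ∈ Finset.range (n + 1),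
      (-1) ^ i * (n.descFactorial i : ℝ) * detIntegral μ K (n - i) * iteratedKernel μ K i x y := by
  induction n generalizing x with
  | zero => simp [fredholmMinor_zero, detIntegral_zero, iteratedKernel]
  | succ n ih =>
    have hint : ∀ i ∈ Finset.range (n + 1), Integrable (fun w => K x w * ((-1) ^ i *
        (n.descFactorial i : ℝ) * detIntegral μ K (n - i) * iteratedKernel μ K i w y)) μ :=
      fun i _ => ((hK.comp (measurable_const.prodMk measurable_id)).mul
        ((BoundedMeasurable.const _).mul ((boundedMeasurable_iteratedKernel μ hK i).comp
          (measurable_id.prodMk measurable_const)))).integrable μ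
    rw [fredholmMinor_succ μ hK, Finset.sum_range_succ']
    simp only [ih, Finset.mul_sum]
    rw [integral_finsetSum _ hint, sub_eq_neg_add, Finset.mul_sum, ← Finset.sum_neg_distrib]
    congr 1
    · refine Finset.sum_congr rfl fun i _ => ?_
      simp only [mul_left_comm (K x _), integral_const_mul]
      rw [Nat.succ_descFactorial_succ, Nat.add_sub_add_right, iteratedKernel]
      push_cast
      ring
    · simp [iteratedKernel, mul_comm]

/-- Setting `y = x` in the unrolled recursion for the minors and integrating yields traces of
iterated kernels; `n.descFactorial i = i ! * n.choose i` brings out the binomial form of the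
cumulant recursion. -/
theorem detIntegral_succ (hK : BoundedMeasurable (Function.uncurry K)) (n : ℕ) :
    detIntegral μ K (n + 1) = ∑ i ∈ Finset.range (n + 1), (n.choose i : ℝ) *
      ((-1) ^ i * (i ! : ℝ) * ∫ x, iteratedKernel μ K i x x ∂μ) * detIntegral μ K (n - i) := by
  have h1 : BoundedMeasurable fun z : Fin (n + 1) → E => (Matrix.of fun i j => K (z i) (z j)).det :=
    boundedMeasurable_kernel_det hK measurable_pi_apply measurable_pi_apply
  have h2 : detIntegral μ K (n + 1) = ∫ x, fredholmMinor μ K n x x ∂μ := by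
    rw [detIntegral, integral_pi_insertNth μ 0 (h1.integrable _)]
    simp only [Fin.insertNth_zero]
    rfl
  have hint : ∀ i ∈ Finset.range (n + 1), Integrable (fun x => (-1) ^ i *
        (n.descFactorial i : ℝ) * detIntegral μ K (n - i) * iteratedKernel μ K i x x) μ :=
    fun i _ => ((BoundedMeasurable.const _).mul ((boundedMeasurable_iteratedKernel μ hK i).comp
          (measurable_id.prodMk measurable_id))).integrable μ
  rw [h2]
  simp only [fredholmMinor_eq_sum μ hK]
  rw [integral_finsetSum _ hint]
  refine Finset.sum_congr rfl fun i _ => ?_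
  rw [integral_const_mul, Nat.descFactorial_eq_factorial_mul_choose]
  push_cast
  ring

theorem measurable_snoc {n : ℕ} {α : Type*} [MeasurableSpace α] {f : α → E} {g : α → Fin n → E}
    (hf : Measurable f) (hg : Measurable g) (i : Fin (n + 1)) :
    Measurable fun t => (Fin.snoc (g t) (f t) : Fin (n + 1) → E) i := by
  simp only [Fin.snoc_eq_cons_rotate]
  exact measurable_cons hf hg _

/-- The product runs along the path from `x` through `z` to `y`: `Fin.cons x z` lists the starts of
its steps, `Fin.snoc z y` their ends. -/
theorem iteratedKernel_eq_integral (hK : BoundedMeasurable (Function.uncurry K)) (j : ℕ)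
    (x y : E) :
    iteratedKernel μ K j x y = ∫ z : Fin j → E, ∏ i : Fin (j + 1),
      K ((Fin.cons x z : Fin (j + 1) → E) i) ((Fin.snoc z y : Fin (j + 1) → E) i)
        ∂(Measure.pi fun _ => μ) := by
  induction j generalizing x with
  | zero => simp [iteratedKernel, Measure.real, Fin.snoc]
  | succ j ih =>
    have h : BoundedMeasurable fun z : Fin (j + 1) → E => ∏ i : Fin (j + 2),
        K ((Fin.cons x z : Fin (j + 2) → E) i) ((Fin.snoc z y : Fin (j + 2) → E) i) :=
      BoundedMeasurable.prod _ fun i => hK.comp ((measurable_cons measurable_const measurable_id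
        i).prodMk (measurable_snoc measurable_const measurable_id i))
    rw [integral_pi_insertNth μ 0 (h.integrable _), iteratedKernel]
    refine integral_congr_ae (Filter.Eventually.of_forall fun w => ?_)
    simp only [ih, Fin.insertNth_zero]
    rw [← integral_const_mul]
    refine integral_congr_ae (Filter.Eventually.of_forall fun z => ?_)
    simp only
    rw [Fin.prod_univ_succ (n := j + 1), ← Fin.cons_snoc_eq_snoc_cons]
    simp

/-- When the path closes up, the ends of the steps are the starts rotated by one. -/
theorem integral_cyclic_prod (hK : BoundedMeasurable (Function.uncurry K)) (j : ℕ) :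
    ∫ z : Fin (j + 1) → E, ∏ i, K (z i) (z (finRotate (j + 1) i)) ∂(Measure.pi fun _ => μ) =
      ∫ x, iteratedKernel μ K j x x ∂μ := by
  have h : BoundedMeasurable fun z : Fin (j + 1) → E => ∏ i, K (z i) (z (finRotate (j + 1) i)) :=
    BoundedMeasurable.prod _ fun i => hK.comp₂
      (measurable_pi_apply i) (measurable_pi_apply (finRotate (j + 1) i))
  rw [integral_pi_insertNth μ 0 (h.integrable _)]
  simp only [iteratedKernel_eq_integral μ hK, Fin.snoc_eq_cons_rotate, Fin.insertNth_zero]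
  rfl

/-- The cumulants of the integrals of determinants are the integrals of cyclic products. -/
theorem sum_blockSum_detIntegral {α : Type*} [DecidableEq α]
    (hK : BoundedMeasurable (Function.uncurry K)) (s : Finset α) (j : ℕ) (hs : s.card = j + 1) :
    ∑ i ∈ Finset.Icc 1 (j + 1),
      (-1 : ℝ) ^ (i - 1) * ((i - 1)! : ℝ) * Finset.blockSum (detIntegral μ K) s i =
    (-1) ^ j * (j ! : ℝ) *
      ∫ z : Fin (j + 1) → E, ∏ i, K (z i) (z (finRotate (j + 1) i)) ∂(Measure.pi fun _ => μ) := by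
  have h := Finset.sum_blockSum_eq_cumulant (detIntegral μ K)
    -- The truncated subtraction at `n = 0` is harmless: only `κ (i + 1)` enters the recursion.
    (fun n => (-1) ^ (n - 1) * ((n - 1)! : ℝ) * ∫ x, iteratedKernel μ K (n - 1) x x ∂μ)
    (detIntegral_zero μ) (detIntegral_succ μ hK) s (Finset.card_pos.mp (by omega))
  rw [hs] at h
  rw [h, integral_cyclic_prod μ hK, Nat.add_sub_cancel]

end Fredholm

/-! ### Application to the determinantal process. -/

namespace DPP

variable {d : ℕ}

open Pointwise in
/-- A continuous stationary kernel agrees, on a bounded set, with a bounded measurable one. -/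
theorem exists_boundedMeasurable_kernel {C : Space d → ℝ} (hC : Continuous C)
    {A : Set (Space d)} (hA : Bornology.IsBounded A) :
    ∃ K : Space d → Space d → ℝ, BoundedMeasurable (Function.uncurry K) ∧
      ∀ x ∈ A, ∀ y ∈ A, K x y = C (x - y) := by
  have hAA : Bornology.IsBounded (A - A) := hA.sub hA
  obtain ⟨M, hM⟩ := hAA.isCompact_closure.exists_bound_of_continuousOn hC.continuousOn
  -- Clamping to `[-|M|, |M|]` bounds the kernel everywhere and changes nothing on `A`; the absolute
  -- value covers a negative `M`, possible for empty `A`.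
  refine ⟨fun x y => max (-|M|) (min (C (x - y)) |M|), ⟨?_, |M|, fun p => ?_⟩, fun x hx y hy => ?_⟩
  · have : Continuous fun p : Space d × Space d => max (-|M|) (min (C (p.1 - p.2)) |M|) := by
      fun_prop
    exact this.measurable
  · rw [Function.uncurry, abs_le]
    exact ⟨le_max_left _ _, max_le (neg_le_self (abs_nonneg M)) (min_le_right _ _)⟩
  · have h := abs_le.mp ((hM (x - y) (subset_closure (Set.sub_mem_sub hx hy))).trans (le_abs_self M))
    simp only [min_eq_left h.2, max_eq_right h.1]

theorem restrict_univ_pi (A : Set (Space d)) (k : ℕ) :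
    (volume : Measure (Fin k → Space d)).restrict (Set.univ.pi fun _ => A) =
      Measure.pi fun _ => volume.restrict A := by
  rw [volume_pi, Measure.restrict_pi_pi]

theorem factorialMoment_pi_eq {Ω : Type*} [MeasurableSpace Ω] {P : Measure Ω}
    {X : Ω → Configuration d} {C : Space d → ℝ} (hDPP : IsDPP P X C) {A : Set (Space d)}
    (hA : Bornology.IsBounded A) (hAm : MeasurableSet A) {K : Space d → Space d → ℝ}
    (hK : BoundedMeasurable (Function.uncurry K)) (hKC : ∀ x ∈ A, ∀ y ∈ A, K x y = C (x - y))
    {r : ℕ} (hr : 1 ≤ r) :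
    factorialMoment P X r (Set.univ.pi fun _ => A) ≠ ∞ ∧
      (factorialMoment P X r (Set.univ.pi fun _ => A)).toReal =
        detIntegral (volume.restrict A) K r := by
  have : IsFiniteMeasure (volume.restrict A) :=
    isFiniteMeasure_restrict.mpr hA.measure_lt_top.ne
  obtain ⟨q, ⟨hqm, hq⟩, hqC⟩ := hDPP r hr
  have hpi : MeasurableSet (Set.univ.pi fun _ : Fin r => A) :=
    MeasurableSet.univ_pi fun _ => hAm
  have hae : ∀ᵐ x ∂(Measure.pi fun _ : Fin r => (volume : Measure (Space d)).restrict A),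
      (q x : ℝ) = (Matrix.of fun i j => K (x i) (x j)).det := by
    rw [← restrict_univ_pi]
    filter_upwards [ae_restrict_of_ae hqC, ae_restrict_mem hpi] with x hx hxA
    rw [hx]
    congr 1
    ext i j
    exact (hKC _ (hxA i trivial) _ (hxA j trivial)).symm
  have hint := (boundedMeasurable_kernel_det (n := r) hK measurable_pi_apply
    measurable_pi_apply).integrable (Measure.pi fun _ => (volume : Measure (Space d)).restrict A)
  -- The determinant is nonnegative almost everywhere on `A^r` because it agrees there with a
  -- density valued in `ℝ≥0`.
  have hnn : 0 ≤ᵐ[Measure.pi fun _ : Fin r => (volume : Measure (Space d)).restrict A]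
      fun x => (Matrix.of fun i j => K (x i) (x j)).det := by
    filter_upwards [hae] with x hx
    rw [← hx]
    exact (q x).2
  have h : factorialMoment P X r (Set.univ.pi fun _ => A) =
      ENNReal.ofReal (detIntegral (volume.restrict A) K r) := by
    rw [hq _ hpi, detIntegral, ofReal_integral_eq_lintegral_ofReal hint hnn, restrict_univ_pi]
    refine lintegral_congr_ae ?_
    filter_upwards [hae] with x hx
    rw [← hx, ENNReal.ofReal_coe_nnreal]
  rw [h]
  exact ⟨ENNReal.ofReal_ne_top, ENNReal.toReal_ofReal (integral_nonneg_of_ae hnn)⟩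

/-- Symmetry of `C` reverses each difference, so that the factors follow the order of the path. -/
theorem cyclicProduct_eq {C : Space d → ℝ} (hC : ∀ x, C (-x) = C x) {A : Set (Space d)}
    {K : Space d → Space d → ℝ} (hKC : ∀ x ∈ A, ∀ y ∈ A, K x y = C (x - y)) {k : ℕ}
    {x : Fin k → Space d} (hx : x ∈ Set.univ.pi fun _ => A) :
    cyclicProduct C x = ∏ i, K (x i) (x (finRotate k i)) := by
  refine Finset.prod_congr rfl fun i _ => ?_
  rw [hKC _ (hx i trivial) _ (hx _ trivial), ← hC, neg_sub]

end DPP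

theorem mainTheorem2 {d : ℕ} {Ω : Type*} [MeasurableSpace Ω] (P : Measure Ω)
    [IsProbabilityMeasure P] (X : Ω → DPP.Configuration d) (hX : Measurable X)
    (C : DPP.Space d → ℝ) (ρ : ℝ) (hC : DPP.ConditionK C ρ) (hDPP : DPP.IsDPP P X C)
    (A : Set (DPP.Space d)) (hA : Bornology.IsBounded A) (hAm : MeasurableSet A)
    (k : ℕ) (hk : 2 ≤ k) :
    (∀ r : ℕ, 1 ≤ r →
      DPP.factorialMoment P X r (Set.univ.pi fun _ => A) ≠ ∞) ∧
    IntegrableOn (DPP.cyclicProduct C) (Set.univ.pi fun _ : Fin k => A) ∧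
    DPP.factorialCumulant P X k (fun _ => A) =
      (-1 : ℝ) ^ (k + 1) * ((k - 1)! : ℝ) *
        ∫ x in Set.univ.pi (fun _ : Fin k => A), DPP.cyclicProduct C x := by
  have : IsFiniteMeasure (volume.restrict A) :=
    isFiniteMeasure_restrict.mpr hA.measure_lt_top.ne
  obtain ⟨K, hK, hKC⟩ := DPP.exists_boundedMeasurable_kernel hC.continuous hA
  have hpi : MeasurableSet (Set.univ.pi fun _ : Fin k => A) :=
    MeasurableSet.univ_pi fun _ => hAm
  have hcyc : Set.EqOn (DPP.cyclicProduct C)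
      (fun x => ∏ i, K (x i) (x (finRotate k i))) (Set.univ.pi fun _ : Fin k => A) :=
    fun x hx => DPP.cyclicProduct_eq hC.symmetric hKC hx
  refine ⟨fun r hr => (DPP.factorialMoment_pi_eq hDPP hA hAm hK hKC hr).1, ?_, ?_⟩
  · rw [integrableOn_congr_fun hcyc hpi, IntegrableOn, DPP.restrict_univ_pi]
    exact (BoundedMeasurable.prod _ fun i => hK.comp₂
      (measurable_pi_apply i) (measurable_pi_apply (finRotate k i))).integrable _
  · obtain ⟨j, rfl⟩ : ∃ j, k = j + 1 := ⟨k - 1, by omega⟩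
    have h := sum_blockSum_detIntegral (volume.restrict A) hK
      (Finset.univ : Finset (Fin (j + 1))) j (by simp)
    rw [setIntegral_congr_fun hpi hcyc, DPP.restrict_univ_pi, Nat.add_sub_cancel,
      show (-1 : ℝ) ^ (j + 1 + 1) = (-1) ^ j by rw [pow_succ, pow_succ]; ring, ← h]
    refine Finset.sum_congr rfl fun i _ => ?_
    congr 1
    refine Finset.sum_congr rfl fun π _ => Finset.prod_congr rfl fun B hB => ?_
    -- Blocks are nonempty, so only moments of order at least 1 occur.
    exact (DPP.factorialMoment_pi_eq hDPP hA hAm hK hKC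
      (Finset.card_pos.mpr (π.nonempty_of_mem_parts hB))).2
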